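/- Let $A:\mathbb{R}\to\mathbb{R}$ be locally Lipschitz (i.e. $A\in W^{1,\infty}_{loc}(\mathbb{R})$), nonnegative and nonincreasing, with finite limits $\bar A:=\lim_{x\to-\infty}A(x)>\underline A:=\lim_{x\to+\infty}A(x)$, and let $c\in\mathbb{R}$. A wave of speed $c$ is a function $w\in C^2(\mathbb{R})$ such that $$w''+cw'+w\int_{-\infty}^x A(y)(-w'(y))\,dy=0\quad\text{for all }x\in\mathbb{R},\qquad 0\le w\le 1,\quad w(-\infty)=1,\quad w(+\infty)=0$$ (where the integrals are absolutely convergent). For every wave $w$ the integral $$\mathcal{I}(w):=\int_{\mathbb{R}}A(y)(-w'(y))\,dy$$ is absolutely convergent, and the following hold. (i) For every $j\in\mathbb{R}$ there is at most one wave $w$ of speed $c$ with $\mathcal{I}(w)=j$. (ii) Any two distinct waves $w_1\ne w_2$ of the same speed $c$ are strictly ordered: either $w_1(x)<w_2(x)$ for all $x\in\mathbb{R}$, or $w_2(x)<w_1(x)$ for all $x\in\mathbb{R}$. -/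

import Mathlib

open MeasureTheory Filter Topology

noncomputable section

namespace NonlocalKPP

/-- `w` is a (classical) traveling wave of speed `c` for the nonlocal KPP problem
`w'' + c w' + w ∫_{-∞}^x A(y) (-w'(y)) dy = 0` on the real line, `0 ≤ w ≤ 1`,
`w(-∞) = 1`, `w(+∞) = 0`.  The field `integrableOn` says that the nonlocal term is a
genuine (absolutely convergent) integral. -/
structure IsWave (A : ℝ → ℝ) (c : ℝ) (w : ℝ → ℝ) : Prop where
  contDiff : ContDiff ℝ 2 w
  integrableOn : ∀ x : ℝ, IntegrableOn (fun y => A y * (-deriv w y)) (Set.Iic x)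
  equation : ∀ x : ℝ,
    deriv (deriv w) x + c * deriv w x + w x * (∫ y in Set.Iic x, A y * (-deriv w y)) = 0
  nonneg : ∀ x : ℝ, 0 ≤ w x
  le_one : ∀ x : ℝ, w x ≤ 1
  tendsto_atBot : Tendsto w atBot (𝓝 1)
  tendsto_atTop : Tendsto w atTop (𝓝 0)

/-- The functional `I(w) = ∫_ℝ A(y) (-w'(y)) dy`. -/
def waveI (A : ℝ → ℝ) (w : ℝ → ℝ) : ℝ := ∫ y, A y * (-deriv w y)

end NonlocalKPP

end

/-!
The weight `A` is only locally Lipschitz, but it is nonincreasing, so integration by parts gives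
`∫_{-∞}^x A H' ≥ A(x) H(x) + m (Ā - A(x))`, where `Ā = A(-∞)`, for every `C¹` function `H` that
vanishes at `-∞` and satisfies `H ≥ m` on `(-∞, x]` (`le_setIntegral_Iic_mul_deriv`). Everything
below exploits this one inequality together with the second-order equation
`w'' + c w' + w J = 0`, `J(x) = ∫_{-∞}^x A (-w')`.

With `H = 1 - w ≥ 0` it yields `J ≥ 0`. Then `e^{cx} w'` is nonincreasing, and a point with `w' > 0`
would make `w` increase from its limit `1` at `-∞`, against `w ≤ 1`; hence `w' ≤ 0`. Therefore
`-w'`, and with it `A (-w')`, is integrable, and a similar argument gives `w > 0`.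

Let `w₁ ≠ w₂` be two waves, `h = w₂ - w₁` and `E = J₁ - J₂ = ∫_{-∞}^x A h'`. The function `h` solves
`h'' = -c h' + w₁ E - h J₂`. If `|h|` had a maximum over `(-∞, x₀]` at `x₀`, with `h(x₀) > 0` and
`h'(x₀) = 0`, the inequality with `m = -h(x₀)` would give
`h''(x₀) ≥ h(x₀) (w₁ (2A - Ā) - J₂)(x₀)`, whose right-hand side is positive for `x₀` near `-∞`, since
there `w₁ → 1`, `A → Ā > 0` and `J₂ → 0`. So `|h|` has no interior maximum near `-∞` and is strictly
increasing there (it is not identically zero near `-∞`, by uniqueness for the linear system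
satisfied by `(h, h', E)`, see `eq_of_eqOn_Iic`). Thus `h` has a strict sign near `-∞`, say `h > 0`,
and `h' ≥ 0` (`exists_lt_and_deriv_le`).

The order then persists (`lt_of_lt_Iic`): as long as `h ≥ 0` on the left one has `E ≥ 0`, and the
Wronskian `W = w₁' w₂ - w₁ w₂'` satisfies `(e^{cx} W)' = -e^{cx} w₁ w₂ E ≤ 0`. It starts nonpositive,
so `w₁ / w₂` is nonincreasing, starts below `1`, and can never reach `1`. This is the strict
ordering. Finally, `I(w₂) < I(w₁)` when `w₁ < w₂` everywhere
(`waveI_lt_waveI`), so equal values of `I` force equal waves: `I(w₁) - I(w₂) = ∫ A h'` is the integral of `h > 0` against the nonzero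
nonnegative measure `-dA`.
-/

namespace NonlocalKPP

open MeasureTheory Filter Topology Set

/-! ### Integration by parts against a nonincreasing weight -/

/-- Integration by parts on a compact interval, with the term `-∫ A' H` bounded below by
`-m ∫ A' = m (A a - A b)`. -/
lemma le_intervalIntegral_mul_deriv {A H : ℝ → ℝ} (hA : LocallyLipschitz A) (hanti : Antitone A)
    (hH : ContDiff ℝ 1 H) {a b m : ℝ} (hab : a ≤ b) (hm : ∀ x ∈ Icc a b, m ≤ H x) :
    A b * H b - A a * H a + m * (A a - A b) ≤ ∫ x in a..b, A x * deriv H x := by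
  obtain ⟨K, hK⟩ := (hA.locallyLipschitzOn (s := uIcc a b)).exists_lipschitzOnWith_of_compact
    isCompact_uIcc
  have hAC := hK.absolutelyContinuousOnInterval
  have hHC : AbsolutelyContinuousOnInterval H a b :=
    ContDiffOn.absolutelyContinuousOnInterval hH.contDiffOn
  rw [hAC.integral_mul_deriv_eq_deriv_mul hHC]
  have h1 : ∫ x in a..b, deriv A x * H x ≤ ∫ x in a..b, deriv A x * m := by
    refine intervalIntegral.integral_mono_on hab
      (hAC.intervalIntegrable_deriv.mul_continuousOn hHC.continuousOn)
      (hAC.intervalIntegrable_deriv.mul_const m) fun x hx => ?_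
    exact mul_le_mul_of_nonpos_left (hm x hx) hanti.deriv_nonpos
  rw [intervalIntegral.integral_mul_const, hAC.integral_deriv_eq_sub] at h1
  linarith

/-- The half-line version of `le_intervalIntegral_mul_deriv`: the boundary term at `-∞` vanishes with
`H`. It bounds the nonlocal term of a wave, and the difference of two of them, from below. -/
lemma le_setIntegral_Iic_mul_deriv {A H : ℝ → ℝ} {Abar : ℝ} (hA : LocallyLipschitz A)
    (hanti : Antitone A) (hbot : Tendsto A atBot (𝓝 Abar))
    (hH : ContDiff ℝ 1 H) (hH0 : Tendsto H atBot (𝓝 0)) {x m : ℝ}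
    (hint : IntegrableOn (fun y => A y * deriv H y) (Iic x)) (hm : ∀ y ≤ x, m ≤ H y) :
    A x * H x + m * (Abar - A x) ≤ ∫ y in Iic x, A y * deriv H y := by
  have h1 := intervalIntegral_tendsto_integral_Iic x hint tendsto_id
  have h2 : Tendsto (fun a => A x * H x - A a * H a + m * (A a - A x)) atBot
      (𝓝 (A x * H x - Abar * 0 + m * (Abar - A x))) :=
    (tendsto_const_nhds.sub (hbot.mul hH0)).add ((hbot.sub_const _).const_mul m)
  simp only [mul_zero, sub_zero] at h2
  refine le_of_tendsto_of_tendsto h2 h1 ?_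
  filter_upwards [eventually_le_atBot x] with a ha
  exact le_intervalIntegral_mul_deriv hA hanti hH ha fun y hy => hm y hy.2

lemma hasDerivAt_setIntegral_Iic {f : ℝ → ℝ} (hf : Continuous f)
    (hint : ∀ x, IntegrableOn f (Iic x)) (x : ℝ) :
    HasDerivAt (fun z => ∫ y in Iic z, f y) (f x) x := by
  have h : (fun z => ∫ y in Iic z, f y) =
      fun z => (∫ y in Iic x, f y) + ∫ y in x..z, f y := by
    funext z
    rw [← intervalIntegral.integral_Iic_sub_Iic (hint x) (hint z)]
    ring
  rw [h]
  exact (hf.integral_hasStrictDerivAt x x).hasDerivAt.const_add _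

/-! ### Properties of a single wave -/

/-- The nonlocal coefficient `J(x) = ∫_{-∞}^x A(y) (-w'(y)) dy` of the wave equation. -/
noncomputable def nonlocalTerm (A w : ℝ → ℝ) (x : ℝ) : ℝ := ∫ y in Iic x, A y * (-deriv w y)

lemma tendsto_nonlocalTerm_atBot (A w : ℝ → ℝ) : Tendsto (nonlocalTerm A w) atBot (𝓝 0) :=
  tendsto_integral_Iic_zero tendsto_id

namespace IsWave

variable {A w w₁ w₂ : ℝ → ℝ} {c Abar Alow : ℝ}

lemma hasDerivAt (hw : IsWave A c w) (x : ℝ) : HasDerivAt w (deriv w x) x :=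
  (hw.contDiff.differentiable (by norm_num) x).hasDerivAt

lemma contDiff_deriv (hw : IsWave A c w) : ContDiff ℝ 1 (deriv w) :=
  ((contDiff_succ_iff_deriv (n := 1)).1 hw.contDiff).2.2

/-- The wave equation, solved for the second derivative. -/
lemma hasDerivAt_deriv (hw : IsWave A c w) (x : ℝ) :
    HasDerivAt (deriv w) (-(c * deriv w x) - w x * nonlocalTerm A w x) x := by
  have h := (hw.contDiff_deriv.differentiable (by norm_num) x).hasDerivAt
  have e := hw.equation x
  refine h.congr_deriv ?_
  simp only [nonlocalTerm]
  linarith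

lemma hasDerivAt_nonlocalTerm (hw : IsWave A c w) (hA : Continuous A) (x : ℝ) :
    HasDerivAt (nonlocalTerm A w) (A x * (-deriv w x)) x :=
  hasDerivAt_setIntegral_Iic (hA.mul hw.contDiff_deriv.continuous.neg) hw.integrableOn x

/-- Nonnegativity of `J` does not presuppose that `w` is monotone: it is the lower bound for
`∫ A H'` with `H = 1 - w ≥ 0`. -/
lemma nonlocalTerm_nonneg (hw : IsWave A c w) (hA : LocallyLipschitz A) (hpos : ∀ x, 0 ≤ A x)
    (hanti : Antitone A) (hbot : Tendsto A atBot (𝓝 Abar)) (x : ℝ) : 0 ≤ nonlocalTerm A w x := by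
  have hd : deriv (fun y => 1 - w y) = fun y => -deriv w y := by
    funext y; exact ((hw.hasDerivAt y).const_sub 1).deriv
  have h := le_setIntegral_Iic_mul_deriv (H := fun y => 1 - w y) (x := x) (m := 0) hA hanti hbot
    (contDiff_const.sub (hw.contDiff.of_le (by norm_num)))
    (by simpa using hw.tendsto_atBot.const_sub 1)
    (by rw [hd]; exact hw.integrableOn x) (fun y _ => sub_nonneg.2 (hw.le_one y))
  rw [hd] at h
  have := mul_nonneg (hpos x) (sub_nonneg.2 (hw.le_one x))
  simp only [nonlocalTerm]
  linarith

/-- The wave equation reads `(e^{cx} w')' = -e^{cx} w J ≤ 0`. -/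
lemma antitone_exp_mul_deriv (hw : IsWave A c w) (hJ : ∀ x, 0 ≤ nonlocalTerm A w x) :
    Antitone fun x => Real.exp (c * x) * deriv w x := by
  have hd : ∀ x, HasDerivAt (fun x => Real.exp (c * x) * deriv w x)
      (-(Real.exp (c * x) * (w x * nonlocalTerm A w x))) x := fun x => by
    have h1 : HasDerivAt (fun x => Real.exp (c * x)) (Real.exp (c * x) * (c * 1)) x :=
      ((hasDerivAt_id x).const_mul c).exp
    exact (h1.fun_mul (hw.hasDerivAt_deriv x)).congr_deriv (by ring)
  refine antitone_of_deriv_nonpos (fun x => (hd x).differentiableAt) fun x => ?_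
  rw [(hd x).deriv]
  have := mul_nonneg (Real.exp_pos (c * x)).le (mul_nonneg (hw.nonneg x) (hJ x))
  linarith

lemma deriv_nonpos (hw : IsWave A c w) (hJ : ∀ x, 0 ≤ nonlocalTerm A w x) (x : ℝ) :
    deriv w x ≤ 0 := by
  by_contra! hx
  have hpos : ∀ y ≤ x, 0 < deriv w y := fun y hy => by
    have h1 : 0 < Real.exp (c * y) * deriv w y :=
      (mul_pos (Real.exp_pos _) hx).trans_le (hw.antitone_exp_mul_deriv hJ hy)
    exact pos_of_mul_pos_right h1 (Real.exp_pos _).le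
  have hmono : StrictMonoOn w (Iic x) :=
    strictMonoOn_of_deriv_pos (convex_Iic x) hw.contDiff.continuous.continuousOn fun y hy =>
      hpos y (interior_subset (s := Iic x) hy)
  have h1 : 1 ≤ w (x - 1) := by
    refine le_of_tendsto hw.tendsto_atBot ?_
    filter_upwards [eventually_le_atBot (x - 1)] with y hy
    exact hmono.monotoneOn (by simp; linarith) (by simp) hy
  have h2 : w (x - 1) < w x := hmono (by simp) (by simp) (by linarith)
  linarith [hw.le_one x]

lemma integrable_mul_neg_deriv (hw : IsWave A c w) (hA : Continuous A) (hpos : ∀ x, 0 ≤ A x)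
    (hanti : Antitone A) (hJ : ∀ x, 0 ≤ nonlocalTerm A w x) :
    Integrable fun y => A y * (-deriv w y) := by
  have h1 : IntegrableOn (deriv w) (Ioi 0) :=
    integrableOn_Ioi_deriv_of_nonpos' (fun x _ => hw.hasDerivAt x)
      (fun x _ => hw.deriv_nonpos hJ x) hw.tendsto_atTop
  have h2 : IntegrableOn (fun y => A y * (-deriv w y)) (Ioi 0) := by
    refine Integrable.mono' ((h1.neg).const_mul (A 0))
      (hA.mul hw.contDiff_deriv.continuous.neg).aestronglyMeasurable.restrict ?_
    refine (ae_restrict_iff' measurableSet_Ioi).2 (Eventually.of_forall fun y hy => ?_)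
    have h3 : 0 ≤ -deriv w y := neg_nonneg.2 (hw.deriv_nonpos hJ y)
    rw [Real.norm_of_nonneg (mul_nonneg (hpos y) h3)]
    exact mul_le_mul_of_nonneg_right (hanti (le_of_lt hy)) h3
  rw [← integrableOn_univ, ← Iic_union_Ioi (a := (0 : ℝ))]
  exact (hw.integrableOn 0).union h2

lemma nonlocalTerm_le_waveI (hw : IsWave A c w) (hA : Continuous A) (hpos : ∀ x, 0 ≤ A x)
    (hanti : Antitone A) (hJ : ∀ x, 0 ≤ nonlocalTerm A w x) (x : ℝ) :
    nonlocalTerm A w x ≤ waveI A w :=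
  setIntegral_le_integral (hw.integrable_mul_neg_deriv hA hpos hanti hJ)
    (Eventually.of_forall fun y => mul_nonneg (hpos y) (neg_nonneg.2 (hw.deriv_nonpos hJ y)))

lemma pos (hw : IsWave A c w) (hJ : ∀ x, 0 ≤ nonlocalTerm A w x) (x : ℝ) : 0 < w x := by
  by_contra! hx
  have hx0 : w x = 0 := le_antisymm hx (hw.nonneg x)
  -- a zero of `w` is a minimum, and the monotonicity of `e^{cx} w'` then freezes `w` on its left
  have hd0 : deriv w x = 0 := by
    have : IsLocalMin w x := Eventually.of_forall fun y => hx0 ▸ hw.nonneg y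
    exact this.deriv_eq_zero
  have hd : ∀ y ≤ x, 0 ≤ deriv w y := fun y hy => by
    have h1 := hw.antitone_exp_mul_deriv hJ hy
    simp only [hd0, mul_zero] at h1
    exact nonneg_of_mul_nonneg_right h1 (Real.exp_pos _)
  have hmono : MonotoneOn w (Iic x) :=
    monotoneOn_of_deriv_nonneg (convex_Iic x) hw.contDiff.continuous.continuousOn
      (hw.contDiff.differentiable (by norm_num)).differentiableOn fun y hy =>
        hd y (interior_subset (s := Iic x) hy)
  have : (1 : ℝ) ≤ 0 := by
    refine le_of_tendsto hw.tendsto_atBot ?_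
    filter_upwards [eventually_le_atBot x] with y hy
    exact hx0 ▸ hmono hy (self_mem_Iic (a := x)) hy
  linarith

/-! ### Comparison of two waves -/

/-- The difference of the nonlocal terms is `∫ A h'` with `h = w₂ - w₁`. -/
lemma nonlocalTerm_sub (h₁ : IsWave A c w₁) (h₂ : IsWave A c w₂) (x : ℝ) :
    nonlocalTerm A w₁ x - nonlocalTerm A w₂ x =
      ∫ y in Iic x, A y * deriv (fun z => w₂ z - w₁ z) y := by
  rw [nonlocalTerm, nonlocalTerm, ← integral_sub (h₁.integrableOn x) (h₂.integrableOn x)]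
  congr 1
  funext y
  rw [((h₂.hasDerivAt y).fun_sub (h₁.hasDerivAt y)).deriv]
  ring

lemma le_nonlocalTerm_sub (h₁ : IsWave A c w₁) (h₂ : IsWave A c w₂) (hA : LocallyLipschitz A)
    (hanti : Antitone A) (hbot : Tendsto A atBot (𝓝 Abar)) {x m : ℝ}
    (hm : ∀ y ≤ x, m ≤ w₂ y - w₁ y) :
    A x * (w₂ x - w₁ x) + m * (Abar - A x) ≤ nonlocalTerm A w₁ x - nonlocalTerm A w₂ x := by
  rw [nonlocalTerm_sub h₁ h₂]
  refine le_setIntegral_Iic_mul_deriv (H := fun z => w₂ z - w₁ z) hA hanti hbot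
    ((h₂.contDiff.sub h₁.contDiff).of_le (by norm_num))
    (by simpa using h₂.tendsto_atBot.sub h₁.tendsto_atBot) ?_ hm
  refine ((h₁.integrableOn x).sub (h₂.integrableOn x)).congr (Eventually.of_forall fun y => ?_)
  simp only [Pi.sub_apply]
  rw [((h₂.hasDerivAt y).fun_sub (h₁.hasDerivAt y)).deriv]
  ring


lemma hasDerivAt_sub (h₁ : IsWave A c w₁) (h₂ : IsWave A c w₂) (x : ℝ) :
    HasDerivAt (fun z => w₂ z - w₁ z) (deriv w₂ x - deriv w₁ x) x :=
  (h₂.hasDerivAt x).fun_sub (h₁.hasDerivAt x)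

/-- The linear equation `h'' = -c h' + w₁ (J₁ - J₂) - h J₂` for `h = w₂ - w₁`. -/
lemma hasDerivAt_deriv_sub (h₁ : IsWave A c w₁) (h₂ : IsWave A c w₂) (x : ℝ) :
    HasDerivAt (fun z => deriv w₂ z - deriv w₁ z)
      (-c * (deriv w₂ x - deriv w₁ x) + w₁ x * (nonlocalTerm A w₁ x - nonlocalTerm A w₂ x) -
        (w₂ x - w₁ x) * nonlocalTerm A w₂ x) x := by
  exact ((h₂.hasDerivAt_deriv x).fun_sub (h₁.hasDerivAt_deriv x)).congr_deriv (by ring)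

lemma hasDerivAt_nonlocalTerm_sub (h₁ : IsWave A c w₁) (h₂ : IsWave A c w₂) (hA : Continuous A)
    (x : ℝ) :
    HasDerivAt (fun z => nonlocalTerm A w₁ z - nonlocalTerm A w₂ z)
      (A x * (deriv w₂ x - deriv w₁ x)) x := by
  exact ((h₁.hasDerivAt_nonlocalTerm hA x).fun_sub
    (h₂.hasDerivAt_nonlocalTerm hA x)).congr_deriv (by ring)

/-- Unique continuation to the right. With `h = w₂ - w₁` and `E = J₁ - J₂`, the triple `(h, h', E)`
solves a linear system with bounded coefficients and vanishes at `x₀`; a Grönwall estimate for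
`h² + h'² + E²` concludes. -/
lemma eq_of_eqOn_Iic (h₁ : IsWave A c w₁) (h₂ : IsWave A c w₂) (hA : LocallyLipschitz A)
    (hpos : ∀ x, 0 ≤ A x) (hanti : Antitone A) (hbot : Tendsto A atBot (𝓝 Abar)) {x₀ : ℝ}
    (heq : ∀ y ≤ x₀, w₁ y = w₂ y) : w₁ = w₂ := by
  have hJ := h₂.nonlocalTerm_nonneg hA hpos hanti hbot
  set h := fun z => w₂ z - w₁ z with hh
  set q := fun z => deriv w₂ z - deriv w₁ z with hq
  set E := fun z => nonlocalTerm A w₁ z - nonlocalTerm A w₂ z with hE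
  have dh : ∀ x, HasDerivAt h (q x) x := h₁.hasDerivAt_sub h₂
  have dq : ∀ x, HasDerivAt q (-c * q x + w₁ x * E x - h x * nonlocalTerm A w₂ x) x :=
    h₁.hasDerivAt_deriv_sub h₂
  have dE : ∀ x, HasDerivAt E (A x * q x) x := h₁.hasDerivAt_nonlocalTerm_sub h₂ hA.continuous
  -- `K` makes `(h² + q² + E²)' ≤ K (h² + q² + E²)`: each cross term `2 r s t` is at most
  -- `r (s² + t²)`, with `r` among `1`, `w₁ ≤ 1`, `J₂ ≤ waveI A w₂` and `A ≤ Abar`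
  set K := 2 + 2 * |c| + waveI A w₂ + Abar with hK
  set N := fun x => Real.exp (-K * x) * (h x ^ 2 + q x ^ 2 + E x ^ 2) with hN
  have dN : ∀ x, HasDerivAt N (Real.exp (-K * x) * (-K) * (h x ^ 2 + q x ^ 2 + E x ^ 2) +
      Real.exp (-K * x) * (2 * h x * q x +
        2 * q x * (-c * q x + w₁ x * E x - h x * nonlocalTerm A w₂ x) +
        2 * E x * (A x * q x))) x := fun x => by
    have h1 : HasDerivAt (fun x => Real.exp (-K * x)) (Real.exp (-K * x) * (-K * 1)) x :=
      ((hasDerivAt_id x).const_mul (-K)).exp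
    refine (h1.fun_mul ((((dh x).fun_pow 2).fun_add ((dq x).fun_pow 2)).fun_add
      ((dE x).fun_pow 2))).congr_deriv ?_
    norm_num
  have hNanti : Antitone N := by
    refine antitone_of_deriv_nonpos (fun x => (dN x).differentiableAt) fun x => ?_
    rw [(dN x).deriv]
    have hexp := Real.exp_pos (-K * x)
    have hb : ∀ {r B : ℝ}, 0 ≤ r → r ≤ B → ∀ s t : ℝ, 2 * r * s * t ≤ B * (s ^ 2 + t ^ 2) :=
      fun hr hB s t =>
        le_trans (by nlinarith [mul_nonneg hr (sq_nonneg (s - t))])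
          (mul_le_mul_of_nonneg_right hB (by positivity))
    have e1 := hb zero_le_one le_rfl (h x) (q x)
    have e2 := hb (h₁.nonneg x) (h₁.le_one x) (q x) (E x)
    have e3 := hb (hJ x)
      (h₂.nonlocalTerm_le_waveI hA.continuous hpos hanti hJ x) (-h x) (q x)
    have e4 := hb (hpos x) (hanti.ge_of_tendsto hbot x) (q x) (E x)
    have e5 : -c * q x ^ 2 ≤ |c| * q x ^ 2 :=
      mul_le_mul_of_nonneg_right (neg_le_abs c) (sq_nonneg _)
    have hI : 0 ≤ waveI A w₂ :=
      (hJ x).trans (h₂.nonlocalTerm_le_waveI hA.continuous hpos hanti hJ x)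
    have hAb : 0 ≤ Abar := (hpos x).trans (hanti.ge_of_tendsto hbot x)
    have f1 := mul_nonneg (abs_nonneg c) (sq_nonneg (h x))
    have f2 := mul_nonneg (abs_nonneg c) (sq_nonneg (E x))
    have f3 := mul_nonneg hI (sq_nonneg (E x))
    have f4 := mul_nonneg hAb (sq_nonneg (h x))
    have key : 2 * h x * q x +
        2 * q x * (-c * q x + w₁ x * E x - h x * nonlocalTerm A w₂ x) +
        2 * E x * (A x * q x) ≤ K * (h x ^ 2 + q x ^ 2 + E x ^ 2) := by
      rw [hK]
      linarith [sq_nonneg (h x), sq_nonneg (E x)]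
    nlinarith [mul_le_mul_of_nonneg_left key hexp.le]
  have hN0 : N x₀ = 0 := by
    have a1 : h x₀ = 0 := by simp [hh, heq x₀ le_rfl]
    -- `h` vanishes identically on the left of `x₀`, hence so does its derivative at `x₀`
    have a2 : q x₀ = 0 := by
      have e1 : derivWithin w₁ (Iic x₀) x₀ = derivWithin w₂ (Iic x₀) x₀ :=
        derivWithin_congr heq (heq x₀ le_rfl)
      rw [(h₁.hasDerivAt x₀).hasDerivWithinAt.derivWithin (uniqueDiffOn_Iic x₀ x₀ self_mem_Iic),
        (h₂.hasDerivAt x₀).hasDerivWithinAt.derivWithin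
          (uniqueDiffOn_Iic x₀ x₀ self_mem_Iic)] at e1
      simp [hq, e1]
    have a3 : E x₀ = 0 := by
      have e1 := h₁.le_nonlocalTerm_sub h₂ hA hanti hbot (x := x₀) (m := 0)
        fun y hy => by rw [heq y hy, sub_self]
      have e2 := h₂.le_nonlocalTerm_sub h₁ hA hanti hbot (x := x₀) (m := 0)
        fun y hy => by rw [heq y hy, sub_self]
      rw [heq x₀ le_rfl] at e1 e2
      simp only [hE]
      linarith
    simp [hN, a1, a2, a3]
  funext x
  rcases le_total x x₀ with hx | hx
  · exact heq x hx
  · have h1 : N x ≤ 0 := hN0 ▸ hNanti hx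
    have h2 : h x ^ 2 + q x ^ 2 + E x ^ 2 ≤ 0 := by
      by_contra! h3
      exact absurd h1 (not_le.2 (mul_pos (Real.exp_pos _) h3))
    have h3 : h x = 0 := by nlinarith [sq_nonneg (h x), sq_nonneg (q x), sq_nonneg (E x)]
    simp only [hh] at h3
    linarith

/-- A maximum principle. The bound on `|w₂ - w₁|` over the whole half-line controls the nonlocal
term, so that `w₂ - w₁` would be strictly convex at a positive local maximum. -/
lemma not_isLocalMax_sub (h₁ : IsWave A c w₁) (h₂ : IsWave A c w₂) (hA : LocallyLipschitz A)
    (hanti : Antitone A) (hbot : Tendsto A atBot (𝓝 Abar)) {x : ℝ}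
    (hx : nonlocalTerm A w₂ x < w₁ x * (2 * A x - Abar)) (hpos : 0 < w₂ x - w₁ x)
    (hsup : ∀ y ≤ x, |w₂ y - w₁ y| ≤ w₂ x - w₁ x) :
    ¬ IsLocalMax (fun z => w₂ z - w₁ z) x := by
  intro hmax
  have hd0 := hmax.deriv_eq_zero
  have hd : deriv (fun z => w₂ z - w₁ z) = fun z => deriv w₂ z - deriv w₁ z :=
    funext fun y => (h₁.hasDerivAt_sub h₂ y).deriv
  have hE := h₁.le_nonlocalTerm_sub h₂ hA hanti hbot (x := x) (m := -(w₂ x - w₁ x))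
    fun y hy => (abs_le.1 (hsup y hy)).1
  have hdd : 0 < deriv (deriv fun z => w₂ z - w₁ z) x := by
    rw [hd, (h₁.hasDerivAt_deriv_sub h₂ x).deriv]
    have e0 : deriv w₂ x - deriv w₁ x = 0 := by rw [hd] at hd0; exact hd0
    rw [e0]
    have e1 := mul_le_mul_of_nonneg_left hE (h₁.nonneg x)
    have e2 := mul_lt_mul_of_pos_left hx hpos
    nlinarith
  have hmin := isLocalMin_of_deriv_deriv_pos hdd hd0 (h₁.hasDerivAt_sub h₂ x).continuousAt
  -- being both a maximum and a minimum, `w₂ - w₁` is locally constant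
  have hconst : (fun z => w₂ z - w₁ z) =ᶠ[𝓝 x] fun _ => w₂ x - w₁ x := by
    filter_upwards [hmax, hmin] with y h1 h2 using le_antisymm h1 h2
  have := hconst.deriv.deriv_eq
  simp only [deriv_const', deriv_const] at this
  linarith

/-- The hypothesis of `not_isLocalMax_sub` holds near `-∞`, where the two sides tend to `0` and
`Abar`. -/
lemma eventually_nonlocalTerm_lt (h₁ : IsWave A c w₁) (hAbar : 0 < Abar)
    (hbot : Tendsto A atBot (𝓝 Abar)) :
    ∀ᶠ x in atBot, nonlocalTerm A w₂ x < w₁ x * (2 * A x - Abar) := by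
  have h := h₁.tendsto_atBot.mul ((hbot.const_mul 2).sub_const Abar)
  exact (tendsto_nonlocalTerm_atBot A w₂).eventually_lt h (by linarith)

/-- Near `-∞`, the distance between two distinct waves is strictly increasing: by the maximum
principle its maximum over a half-line `(-∞, x]` is attained at `x` only. -/
lemma abs_sub_lt_abs_sub (h₁ : IsWave A c w₁) (h₂ : IsWave A c w₂) (hA : LocallyLipschitz A)
    (hpos : ∀ x, 0 ≤ A x) (hanti : Antitone A) (hbot : Tendsto A atBot (𝓝 Abar)) (hne : w₁ ≠ w₂)
    {x : ℝ} (hx₁ : ∀ y ≤ x, nonlocalTerm A w₂ y < w₁ y * (2 * A y - Abar))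
    (hx₂ : ∀ y ≤ x, nonlocalTerm A w₁ y < w₂ y * (2 * A y - Abar)) {y : ℝ} (hy : y < x) :
    |w₂ y - w₁ y| < |w₂ x - w₁ x| := by
  obtain ⟨z, hzx, hz⟩ : ∃ z ≤ x, w₁ z ≠ w₂ z := by
    by_contra! h
    exact hne (h₁.eq_of_eqOn_Iic h₂ hA hpos hanti hbot h)
  have hcont : Continuous fun z => |w₂ z - w₁ z| :=
    (h₂.contDiff.continuous.sub h₁.contDiff.continuous).abs
  have hlim : Tendsto (fun z => |w₂ z - w₁ z|) atBot (𝓝 0) := by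
    simpa using (h₂.tendsto_atBot.sub h₁.tendsto_atBot).abs
  have hzpos : 0 < |w₂ z - w₁ z| := abs_pos.2 (sub_ne_zero.2 hz.symm)
  obtain ⟨x₀, hx₀, hmax⟩ := hcont.continuousOn.exists_isMaxOn' isClosed_Iic (x₀ := z) hzx (by
    obtain ⟨b, hb⟩ := eventually_atBot.1 (hlim.eventually_le_const hzpos)
    refine mem_inf_of_inter (isCompact_Icc (a := b) (b := x)).compl_mem_cocompact
      (mem_principal_self _) ?_
    rintro t ⟨ht1, ht2⟩
    refine hb t (le_of_not_ge fun h => ht1 ⟨h, ht2⟩))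
  -- the maximum over `(-∞, x]` cannot sit at an interior point
  have hend : ∀ x₀ ≤ x, (∀ t ≤ x, |w₂ t - w₁ t| ≤ |w₂ x₀ - w₁ x₀|) → x₀ = x := by
    intro x₀ hx₀ hmax
    by_contra hne'
    have hx₀pos : 0 < |w₂ x₀ - w₁ x₀| := hzpos.trans_le (hmax z hzx)
    have hlt : x₀ < x := lt_of_le_of_ne hx₀ hne'
    have hloc : ∀ᶠ t in 𝓝 x₀, |w₂ t - w₁ t| ≤ |w₂ x₀ - w₁ x₀| := by
      filter_upwards [Iio_mem_nhds hlt] with t ht using hmax t (le_of_lt ht)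
    rcases lt_or_gt_of_ne (abs_pos.1 hx₀pos) with hs | hs
    · rw [abs_of_neg hs, neg_sub] at hloc
      refine h₂.not_isLocalMax_sub h₁ hA hanti hbot (hx₂ x₀ hx₀) (by linarith) (fun t ht => ?_) ?_
      · have := hmax t (ht.trans hx₀)
        rwa [abs_of_neg hs, neg_sub, abs_sub_comm] at this
      · filter_upwards [hloc] with t ht
        rw [abs_sub_comm] at ht
        exact (le_abs_self _).trans ht
    · rw [abs_of_pos hs] at hloc
      refine h₁.not_isLocalMax_sub h₂ hA hanti hbot (hx₁ x₀ hx₀) hs (fun t ht => ?_) ?_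
      · have := hmax t (ht.trans hx₀)
        rwa [abs_of_pos hs] at this
      · filter_upwards [hloc] with t ht
        exact (le_abs_self _).trans ht
  have hx₀x : x₀ = x := hend x₀ hx₀ fun t ht => hmax ht
  rw [hx₀x] at hmax
  refine lt_of_le_of_ne (hmax (le_of_lt hy)) fun heq => hy.ne ?_
  exact hend y hy.le fun t ht => heq ▸ hmax ht

/-- Far to the left, two distinct waves are strictly ordered, and the smaller one decreases at least
as fast as the larger one. -/
lemma exists_lt_and_deriv_le (h₁ : IsWave A c w₁) (h₂ : IsWave A c w₂) (hA : LocallyLipschitz A)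
    (hpos : ∀ x, 0 ≤ A x) (hanti : Antitone A) (hAbar : 0 < Abar)
    (hbot : Tendsto A atBot (𝓝 Abar)) (hne : w₁ ≠ w₂) :
    ∃ X, ((∀ y ≤ X, w₁ y < w₂ y) ∧ deriv w₁ X ≤ deriv w₂ X) ∨
      ((∀ y ≤ X, w₂ y < w₁ y) ∧ deriv w₂ X ≤ deriv w₁ X) := by
  obtain ⟨X, hX⟩ := eventually_atBot.1 ((h₁.eventually_nonlocalTerm_lt (w₂ := w₂) hAbar hbot).and
    (h₂.eventually_nonlocalTerm_lt (w₂ := w₁) hAbar hbot))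
  have hmono : ∀ x ≤ X, ∀ y < x, |w₂ y - w₁ y| < |w₂ x - w₁ x| := fun x hx y hy =>
    h₁.abs_sub_lt_abs_sub h₂ hA hpos hanti hbot hne (fun t ht => (hX t (ht.trans hx)).1)
      (fun t ht => (hX t (ht.trans hx)).2) hy
  have hne0 : ∀ x ≤ X, w₂ x - w₁ x ≠ 0 := fun x hx =>
    abs_pos.1 ((abs_nonneg _).trans_lt (hmono x hx (x - 1) (by linarith)))
  have hcont : Continuous fun z => w₂ z - w₁ z := h₂.contDiff.continuous.sub h₁.contDiff.continuous
  -- a left-sided difference quotient at `X` determines the sign of the derivative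
  have hside : ∀ {v : ℝ → ℝ} {v' : ℝ}, HasDerivAt v v' X → (∀ y < X, v y ≤ v X) → 0 ≤ v' := by
    intro v v' hv hle
    refine ge_of_tendsto (hv.tendsto_slope.mono_left
      (nhdsWithin_mono X fun y (hy : y ∈ Iio X) => ne_of_lt hy)) ?_
    filter_upwards [self_mem_nhdsWithin] with y hy
    rw [slope_def_field]
    exact div_nonneg_of_nonpos (sub_nonpos.2 (hle y hy)) (sub_nonpos.2 (le_of_lt hy))
  refine ⟨X, ?_⟩
  -- `w₂ - w₁` has no zero on `(-∞, X]`, so its sign there is the one at `X`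
  rcases lt_or_gt_of_ne (hne0 X le_rfl) with hs | hs
  · right
    have hlt : ∀ y ≤ X, w₂ y - w₁ y < 0 := fun y hy => by
      by_contra! hy0
      obtain ⟨z, hz, hz0⟩ := isPreconnected_Iic.intermediate_value (self_mem_Iic (a := X)) hy
        hcont.continuousOn ⟨hs.le, hy0⟩
      exact hne0 z hz hz0
    refine ⟨fun y hy => sub_neg.1 (hlt y hy), ?_⟩
    refine sub_nonneg.1 (hside (h₂.hasDerivAt_sub h₁ X) fun y hy => ?_)
    have h1 := hmono X le_rfl y hy
    rw [abs_of_neg hs, abs_of_neg (hlt y hy.le)] at h1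
    linarith
  · left
    have hlt : ∀ y ≤ X, 0 < w₂ y - w₁ y := fun y hy => by
      by_contra! hy0
      obtain ⟨z, hz, hz0⟩ := isPreconnected_Iic.intermediate_value hy (self_mem_Iic (a := X))
        hcont.continuousOn ⟨hy0, hs.le⟩
      exact hne0 z hz hz0
    refine ⟨fun y hy => sub_pos.1 (hlt y hy), ?_⟩
    refine sub_nonneg.1 (hside (h₁.hasDerivAt_sub h₂ X) fun y hy => ?_)
    have h1 := hmono X le_rfl y hy
    rw [abs_of_pos hs, abs_of_pos (hlt y hy.le)] at h1
    linarith

/-- The order near `-∞` propagates to the whole line: while it holds, the Wronskian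
`w₁' w₂ - w₁ w₂'` stays nonpositive and the ratio `w₁ / w₂` cannot increase to `1`. -/
lemma lt_of_lt_Iic (h₁ : IsWave A c w₁) (h₂ : IsWave A c w₂) (hA : LocallyLipschitz A)
    (hpos : ∀ x, 0 ≤ A x) (hanti : Antitone A) (hbot : Tendsto A atBot (𝓝 Abar)) {X : ℝ}
    (hlt : ∀ y ≤ X, w₁ y < w₂ y) (hderiv : deriv w₁ X ≤ deriv w₂ X) (x : ℝ) : w₁ x < w₂ x := by
  have hJ₁ := h₁.nonlocalTerm_nonneg hA hpos hanti hbot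
  have hJ₂ := h₂.nonlocalTerm_nonneg hA hpos hanti hbot
  by_contra! hx
  -- the first point `b` at which the order is lost
  set S := {z | w₂ z ≤ w₁ z}
  have hSc : IsClosed S := isClosed_le h₂.contDiff.continuous h₁.contDiff.continuous
  have hSb : BddBelow S := ⟨X, fun z hz => le_of_not_gt fun h => (hlt z h.le).not_ge hz⟩
  set b := sInf S
  have hbS : w₂ b ≤ w₁ b := hSc.csInf_mem ⟨x, hx⟩ hSb
  have hbelow : ∀ y < b, w₁ y < w₂ y := fun y hy => by
    by_contra! h
    exact (csInf_le hSb h).not_gt hy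
  have hXb : X < b := lt_of_not_ge fun h => (hlt b h).not_ge hbS
  have hbeq : w₁ b ≤ w₂ b := by
    have t₁ : Tendsto w₁ (𝓝[<] b) (𝓝 (w₁ b)) := h₁.contDiff.continuous.continuousWithinAt
    have t₂ : Tendsto w₂ (𝓝[<] b) (𝓝 (w₂ b)) := h₂.contDiff.continuous.continuousWithinAt
    refine le_of_tendsto_of_tendsto t₁ t₂ ?_
    filter_upwards [self_mem_nhdsWithin] with y hy using (hbelow y hy).le
  have hle : ∀ y ≤ b, w₁ y ≤ w₂ y := fun y hy =>
    (lt_or_eq_of_le hy).elim (fun h => (hbelow y h).le) fun h => h ▸ hbeq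
  have hJ : ∀ y ≤ b, 0 ≤ nonlocalTerm A w₁ y - nonlocalTerm A w₂ y := fun y hy => by
    have h := h₁.le_nonlocalTerm_sub h₂ hA hanti hbot (x := y) (m := 0)
      fun z hz => sub_nonneg.2 (hle z (hz.trans hy))
    linarith [mul_nonneg (hpos y) (sub_nonneg.2 (hle y hy))]
  -- the Wronskian, weighted by `e^{cx}`, is nonincreasing on `[X, b]` and nonpositive at `X`
  set W := fun z => Real.exp (c * z) * (deriv w₁ z * w₂ z - w₁ z * deriv w₂ z) with hW
  have dW : ∀ z, HasDerivAt W (-(Real.exp (c * z) * (w₁ z * w₂ z *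
      (nonlocalTerm A w₁ z - nonlocalTerm A w₂ z)))) z := fun z => by
    have h0 : HasDerivAt (fun x => Real.exp (c * x)) (Real.exp (c * z) * (c * 1)) z :=
      ((hasDerivAt_id z).const_mul c).exp
    exact (h0.fun_mul (((h₁.hasDerivAt_deriv z).fun_mul (h₂.hasDerivAt z)).fun_sub
      ((h₁.hasDerivAt z).fun_mul (h₂.hasDerivAt_deriv z)))).congr_deriv (by ring)
  have hWanti : AntitoneOn W (Icc X b) := by
    refine antitoneOn_of_deriv_nonpos (convex_Icc X b)
      (fun z _ => (dW z).continuousAt.continuousWithinAt)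
      (fun z _ => (dW z).differentiableAt.differentiableWithinAt) fun z hz => ?_
    rw [(dW z).deriv, neg_nonpos]
    exact mul_nonneg (Real.exp_pos _).le (mul_nonneg (mul_nonneg (h₁.nonneg z) (h₂.nonneg z))
      (hJ z (interior_subset (s := Icc X b) hz).2))
  have hWX : W X ≤ 0 := by
    refine mul_nonpos_of_nonneg_of_nonpos (Real.exp_pos _).le ?_
    have e1 := mul_le_mul_of_nonneg_left hderiv (h₁.nonneg X)
    have e2 := mul_nonpos_of_nonpos_of_nonneg (h₁.deriv_nonpos hJ₁ X)
      (sub_nonneg.2 (hlt X le_rfl).le)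
    linarith
  have hratio : AntitoneOn (fun z => w₁ z / w₂ z) (Icc X b) := by
    have hd : ∀ z, HasDerivAt (fun z => w₁ z / w₂ z)
        ((deriv w₁ z * w₂ z - w₁ z * deriv w₂ z) / w₂ z ^ 2) z := fun z =>
      (h₁.hasDerivAt z).fun_div (h₂.hasDerivAt z) (h₂.pos hJ₂ z).ne'
    refine antitoneOn_of_deriv_nonpos (convex_Icc X b)
      (fun z _ => (hd z).continuousAt.continuousWithinAt)
      (fun z _ => (hd z).differentiableAt.differentiableWithinAt) fun z hz => ?_
    have hz' := interior_subset (s := Icc X b) hz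
    have h1 : W z ≤ 0 := (hWanti (left_mem_Icc.2 hXb.le) hz' hz'.1).trans hWX
    rw [(hd z).deriv]
    refine div_nonpos_of_nonpos_of_nonneg ?_ (sq_nonneg _)
    by_contra! h2
    exact h1.not_gt (mul_pos (Real.exp_pos _) h2)
  have h1 := hratio (left_mem_Icc.2 hXb.le) (right_mem_Icc.2 hXb.le) hXb.le
  have h2 : w₁ X / w₂ X < 1 := (div_lt_one (h₂.pos hJ₂ X)).2 (hlt X le_rfl)
  have h3 : 1 ≤ w₁ b / w₂ b := (one_le_div (h₂.pos hJ₂ b)).2 hbS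
  linarith

/-- The functional `waveI` reverses the strict order. A strict gain arises on an interval `[a, b]`
with `A b < A a`, where `w₂ - w₁` is bounded below by a positive constant. -/
lemma waveI_lt_waveI (h₁ : IsWave A c w₁) (h₂ : IsWave A c w₂) (hA : LocallyLipschitz A)
    (hpos : ∀ x, 0 ≤ A x) (hanti : Antitone A) (hbot : Tendsto A atBot (𝓝 Abar))
    (htop : Tendsto A atTop (𝓝 Alow)) (hA_lt : Alow < Abar) (hlt : ∀ x, w₁ x < w₂ x) :
    waveI A w₂ < waveI A w₁ := by
  obtain ⟨a, b, hab, hAab⟩ : ∃ a b, a ≤ b ∧ A b < A a := by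
    by_contra! h
    have hconst : ∀ y, A y = A 0 := fun y => by
      rcases le_total y 0 with hy | hy
      · exact le_antisymm (h y 0 hy) (hanti hy)
      · exact le_antisymm (hanti hy) (h 0 y hy)
    have e1 := tendsto_nhds_unique hbot (tendsto_const_nhds.congr fun y => (hconst y).symm)
    have e2 := tendsto_nhds_unique htop (tendsto_const_nhds.congr fun y => (hconst y).symm)
    linarith
  set H := fun z => w₂ z - w₁ z with hH
  have hHC : ContDiff ℝ 1 H := (h₂.contDiff.sub h₁.contDiff).of_le (by norm_num)
  have hHpos : ∀ x, 0 < H x := fun x => sub_pos.2 (hlt x)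
  obtain ⟨z, -, hz⟩ := isCompact_Icc.exists_isMinOn (nonempty_Icc.2 hab) hHC.continuous.continuousOn
  have hcA : Continuous fun y => A y * deriv H y :=
    hA.continuous.mul (hHC.continuous_deriv le_rfl)
  have hI₁ := h₁.integrable_mul_neg_deriv hA.continuous hpos hanti
    (h₁.nonlocalTerm_nonneg hA hpos hanti hbot)
  have hI₂ := h₂.integrable_mul_neg_deriv hA.continuous hpos hanti
    (h₂.nonlocalTerm_nonneg hA hpos hanti hbot)
  have hfun : (fun y => A y * deriv H y) =
      fun y => A y * (-deriv w₁ y) - A y * (-deriv w₂ y) := by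
    funext y
    rw [(h₁.hasDerivAt_sub h₂ y).deriv]; ring
  have hint : Integrable fun y => A y * deriv H y := hfun ▸ hI₁.sub hI₂
  have hdiff : waveI A w₁ - waveI A w₂ = ∫ y, A y * deriv H y := by
    rw [hfun, integral_sub hI₁ hI₂]; rfl
  -- `z` minimizes `w₂ - w₁` over `[a, b]`
  have hgain : 0 < H z * (A a - A b) := mul_pos (hHpos z) (sub_pos.2 hAab)
  have hlim := intervalIntegral_tendsto_integral hint tendsto_neg_atTop_atBot tendsto_id
  have hlow : Tendsto (fun t => H z * (A a - A b) - A (-t) * H (-t)) atTop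
      (𝓝 (H z * (A a - A b) - Abar * 0)) := by
    refine tendsto_const_nhds.sub ((hbot.comp tendsto_neg_atTop_atBot).mul ?_)
    have : Tendsto H atBot (𝓝 0) := by simpa using h₂.tendsto_atBot.sub h₁.tendsto_atBot
    exact this.comp tendsto_neg_atTop_atBot
  have hle : H z * (A a - A b) - Abar * 0 ≤ ∫ y, A y * deriv H y := by
    refine le_of_tendsto_of_tendsto hlow hlim ?_
    filter_upwards [eventually_ge_atTop (-a), eventually_ge_atTop b] with t hta htb
    have i1 := le_intervalIntegral_mul_deriv hA hanti hHC (a := -t) (b := a) (m := 0)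
      (by linarith) fun y _ => (hHpos y).le
    have i2 := le_intervalIntegral_mul_deriv hA hanti hHC hab fun y hy => hz hy
    have i3 := le_intervalIntegral_mul_deriv hA hanti hHC (m := 0) htb fun y _ => (hHpos y).le
    have e1 := intervalIntegral.integral_add_adjacent_intervals
      (hcA.intervalIntegrable (μ := volume) (-t) a) (hcA.intervalIntegrable a b)
    have e2 := intervalIntegral.integral_add_adjacent_intervals
      (hcA.intervalIntegrable (μ := volume) (-t) b) (hcA.intervalIntegrable b t)
    have := mul_nonneg (hpos t) (hHpos t).le
    simp only [id]
    linarith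
  linarith

/-- Distinct waves of the same speed are strictly ordered. -/
lemma lt_or_gt (h₁ : IsWave A c w₁) (h₂ : IsWave A c w₂) (hA : LocallyLipschitz A)
    (hpos : ∀ x, 0 ≤ A x) (hanti : Antitone A) (hAbar : 0 < Abar)
    (hbot : Tendsto A atBot (𝓝 Abar)) (hne : w₁ ≠ w₂) :
    (∀ x, w₁ x < w₂ x) ∨ (∀ x, w₂ x < w₁ x) := by
  obtain ⟨X, h | h⟩ := h₁.exists_lt_and_deriv_le h₂ hA hpos hanti hAbar hbot hne
  · exact Or.inl (h₁.lt_of_lt_Iic h₂ hA hpos hanti hbot h.1 h.2)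
  · exact Or.inr (h₂.lt_of_lt_Iic h₁ hA hpos hanti hbot h.1 h.2)

end IsWave
end NonlocalKPP

theorem mainTheorem8 (A : ℝ → ℝ) (Abar Alow : ℝ)
    (hA_lip : LocallyLipschitz A) (hA_nonneg : ∀ x, 0 ≤ A x) (hA_anti : Antitone A)
    (hA_bot : Filter.Tendsto A Filter.atBot (nhds Abar))
    (hA_top : Filter.Tendsto A Filter.atTop (nhds Alow))
    (hA_lt : Alow < Abar) (c : ℝ) :
    (∀ w : ℝ → ℝ, NonlocalKPP.IsWave A c w →
      MeasureTheory.Integrable (fun y => A y * (-deriv w y))) ∧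
    (∀ (j : ℝ) (w₁ w₂ : ℝ → ℝ), NonlocalKPP.IsWave A c w₁ → NonlocalKPP.IsWave A c w₂ →
      NonlocalKPP.waveI A w₁ = j → NonlocalKPP.waveI A w₂ = j → w₁ = w₂) ∧
    (∀ w₁ w₂ : ℝ → ℝ, NonlocalKPP.IsWave A c w₁ → NonlocalKPP.IsWave A c w₂ → w₁ ≠ w₂ →
      (∀ x, w₁ x < w₂ x) ∨ (∀ x, w₂ x < w₁ x)) := by
  have hAbar : 0 < Abar := (ge_of_tendsto' hA_top hA_nonneg).trans_lt hA_lt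
  refine ⟨fun w hw => hw.integrable_mul_neg_deriv hA_lip.continuous hA_nonneg hA_anti
    (hw.nonlocalTerm_nonneg hA_lip hA_nonneg hA_anti hA_bot), ?_, fun w₁ w₂ h₁ h₂ =>
    h₁.lt_or_gt h₂ hA_lip hA_nonneg hA_anti hAbar hA_bot⟩
  intro j w₁ w₂ h₁ h₂ hj₁ hj₂
  by_contra hne
  rcases h₁.lt_or_gt h₂ hA_lip hA_nonneg hA_anti hAbar hA_bot hne with h | h
  · have := h₁.waveI_lt_waveI h₂ hA_lip hA_nonneg hA_anti hA_bot hA_top hA_lt h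
    linarith
  · have := h₂.waveI_lt_waveI h₁ hA_lip hA_nonneg hA_anti hA_bot hA_top hA_lt h
    linarith
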